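/- (Quasirandomness estimates.) For a positive integer $q$ let $\mathrm{Sp}_{2g}(\mathbb{Z}/q\mathbb{Z})$ be the group of $2g\times 2g$ matrices over $\mathbb{Z}/q\mathbb{Z}$ preserving the standard symplectic form. Let $g\ge 2$. For every real $D$ with $0<D<\tfrac12$ there is a constant $C>0$, depending only on $g$ and $D$, such that for every integer $q\ge 1$, every irreducible complex representation of $\mathrm{Sp}_{2g}(\mathbb{Z}/q\mathbb{Z})$ that does not factor through the reduction homomorphism $\mathrm{Sp}_{2g}(\mathbb{Z}/q\mathbb{Z})\to\mathrm{Sp}_{2g}(\mathbb{Z}/q_1\mathbb{Z})$ for any proper divisor $q_1$ of $q$ (that is, $q_1\mid q$, $q_1\neq q$) has dimension at least $C q^{D}$. -/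

import Mathlib

/-- The group `Sp_{2g}(ℤ/qℤ)` of `2g × 2g` matrices over `ℤ/qℤ` preserving the standard
symplectic form. -/
abbrev SpMod (g q : ℕ) : Type :=
  Matrix.symplecticGroup (Fin g) (ZMod q)

/-- Entrywise reduction `Sp_{2g}(ℤ/qℤ) → Sp_{2g}(ℤ/q₁ℤ)` modulo a divisor `q₁` of `q`. -/
def SpMod.reduction (g : ℕ) {q₁ q : ℕ} (h : q₁ ∣ q) : SpMod g q →* SpMod g q₁ where
  toFun A := ⟨A.1.map (ZMod.castHom h (ZMod q₁)), SymplecticGroup.map_mem A.2 _⟩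
  map_one' := Subtype.ext (map_one (ZMod.castHom h (ZMod q₁)).mapMatrix)
  map_mul' A B := Subtype.ext (map_mul (ZMod.castHom h (ZMod q₁)).mapMatrix A.1 B.1)

/-- The complex representation `ρ` of `Sp_{2g}(ℤ/qℤ)` factors through reduction modulo `q₁`. -/
def SpMod.FactorsThrough {g q : ℕ} {V : Type*} [AddCommGroup V] [Module ℂ V]
    (ρ : Representation ℂ (SpMod g q) V) (q₁ : ℕ) (h : q₁ ∣ q) : Prop :=
  ∃ ρ' : Representation ℂ (SpMod g q₁) V, ρ = ρ'.comp (SpMod.reduction g h)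

/-- `ρ` is new: it does not factor through reduction modulo any proper divisor of `q`. -/
def SpMod.IsNew {g q : ℕ} {V : Type*} [AddCommGroup V] [Module ℂ V]
    (ρ : Representation ℂ (SpMod g q) V) : Prop :=
  ∀ (q₁ : ℕ) (h : q₁ ∣ q), q₁ ≠ q → ¬ SpMod.FactorsThrough ρ q₁ h

/-! Let `T` be the transvection along a basis vector `e` and `f` its image under `ρ`, so `f ^ q =
1`. Suppose `f` has an eigenvalue `ζ` of order exactly `q`. Conjugation by `diag(u, u⁻¹)` turns `T`
into `T ^ (u ^ 2)`, so every `ζ ^ (u ^ 2)` is an eigenvalue, and the dimension is at least the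
number of squares of units modulo `q` (`card_sq_le_finrank`). At most `2 τ(q) ≤ 4 √q` units have
square 1, and `φ(q) ≫ q ^ (1 - ε)`, which gives every exponent `D < 1/2`.

Since `f` is diagonalizable, such a `ζ` exists unless the product of `f ^ (q / p) - 1` over the
primes `p ∣ q` vanishes. No single factor vanishes: the normal closure of `T ^ (q / p)` is the
kernel of reduction modulo `q / p`, so `ρ` would factor (`factorsThrough_of_transvection_eq_one`).
This uses that transvections generate the congruence kernels and that `Sp` is transitive on nonzero
vectors over `𝔽_p`. The product does not vanish either: by the Chinese remainder theorem its factors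
live on commuting parts of the group, and irreducibility keeps their product nonzero
(`aeval_prod_primeFactors_ne_zero`). -/

namespace SymplecticGroup

open Matrix

/-! ### Symplectic transvections over a commutative ring, with `ω(x, y) = (J x) ⬝ᵥ y` -/

section Transvection

variable {l R : Type*} [DecidableEq l] [Fintype l] [CommRing R]

theorem J_mulVec_dotProduct (x y : l ⊕ l → R) :
    (J l R *ᵥ x) ⬝ᵥ y = -(x ⬝ᵥ (J l R *ᵥ y)) := by
  rw [dotProduct_comm, dotProduct_mulVec, ← mulVec_transpose, J_transpose, neg_mulVec,
    neg_dotProduct, dotProduct_comm]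

theorem J_mulVec_dotProduct_self (x : l ⊕ l → R) : (J l R *ᵥ x) ⬝ᵥ x = 0 := by
  simp [J, fromBlocks_mulVec, dotProduct, Fintype.sum_sum_type, mul_comm, neg_mulVec]

theorem J_mulVec_J_mulVec (x : l ⊕ l → R) : J l R *ᵥ (J l R *ᵥ x) = -x := by
  rw [mulVec_mulVec, J_squared, neg_mulVec, one_mulVec]

theorem J_mulVec_dotProduct_comm (x y : l ⊕ l → R) :
    (J l R *ᵥ x) ⬝ᵥ y = -((J l R *ᵥ y) ⬝ᵥ x) := by
  rw [J_mulVec_dotProduct, dotProduct_comm]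

theorem J_mulVec_mulVec_dotProduct_mulVec (A : symplecticGroup l R) (x y : l ⊕ l → R) :
    (J l R *ᵥ (A.1 *ᵥ x)) ⬝ᵥ (A.1 *ᵥ y) = (J l R *ᵥ x) ⬝ᵥ y := by
  have h := mem_iff'.1 A.2
  rw [J_mulVec_dotProduct, J_mulVec_dotProduct, ← vecMul_transpose, ← dotProduct_mulVec,
    mulVec_mulVec, mulVec_mulVec, h]

theorem vecMulVec_J_mulVec_mul_J (v : l ⊕ l → R) :
    vecMulVec v (J l R *ᵥ v) * J l R = vecMulVec v v := by
  rw [vecMulVec_mul, ← mulVec_transpose, J_transpose, neg_mulVec, J_mulVec_J_mulVec, neg_neg]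

/-- The symplectic transvection `x ↦ x + t ω(v, x) v`. -/
def transvection (v : l ⊕ l → R) (t : R) : symplecticGroup l R :=
  ⟨1 + t • vecMulVec v (J l R *ᵥ v), by
    have h1 := vecMulVec_J_mulVec_mul_J v
    have h2 : J l R * vecMulVec (J l R *ᵥ v) v = -vecMulVec v v := by
      rw [mul_vecMulVec, J_mulVec_J_mulVec, neg_vecMulVec]
    have h3 : vecMulVec v v * vecMulVec (J l R *ᵥ v) v = 0 := by
      rw [vecMulVec_mul_vecMulVec, dotProduct_comm, J_mulVec_dotProduct_self, zero_smul,
        vecMulVec_zero]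
    rw [mem_iff, transpose_add, transpose_one, transpose_smul, transpose_vecMulVec, add_mul,
      one_mul, smul_mul_assoc, h1, mul_add, mul_one, add_mul, mul_smul_comm, h2, smul_mul_assoc,
      mul_smul_comm, h3]
    simp⟩

theorem coe_transvection (v : l ⊕ l → R) (t : R) :
    (transvection v t).1 = 1 + t • vecMulVec v (J l R *ᵥ v) := rfl

theorem transvection_mulVec (v : l ⊕ l → R) (t : R) (x : l ⊕ l → R) :
    (transvection v t).1 *ᵥ x = x + (t * ((J l R *ᵥ v) ⬝ᵥ x)) • v := by
  rw [coe_transvection, add_mulVec, one_mulVec, smul_mulVec, vecMulVec_mulVec, op_smul_eq_smul,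
    smul_smul]

theorem ext_mulVec {A B : symplecticGroup l R} (h : ∀ x, A.1 *ᵥ x = B.1 *ᵥ x) : A = B :=
  Subtype.ext (mulVec_injective (funext h))

theorem transvection_add (v : l ⊕ l → R) (s t : R) :
    transvection v (s + t) = transvection v s * transvection v t := by
  refine ext_mulVec fun x ↦ ?_
  rw [Submonoid.coe_mul, ← mulVec_mulVec]
  simp only [transvection_mulVec, dotProduct_add, dotProduct_smul, J_mulVec_dotProduct_self]
  module

theorem transvection_zero (v : l ⊕ l → R) : transvection v 0 = 1 :=
  Subtype.ext (by simp [coe_transvection])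

theorem transvection_natCast (v : l ⊕ l → R) (n : ℕ) :
    transvection v (n : R) = transvection v 1 ^ n := by
  induction n with
  | zero => simp [transvection_zero]
  | succ n ih => rw [Nat.cast_succ, transvection_add, ih, pow_succ]

theorem transvection_smul (a : R) (v : l ⊕ l → R) (t : R) :
    transvection (a • v) t = transvection v (a ^ 2 * t) := by
  refine ext_mulVec fun x ↦ ?_
  simp only [transvection_mulVec, mulVec_smul, smul_dotProduct]
  module

theorem conj_transvection (A : symplecticGroup l R) (v : l ⊕ l → R) (t : R) :
    A * transvection v t * A⁻¹ = transvection (A.1 *ᵥ v) t := by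
  rw [mul_inv_eq_iff_eq_mul]
  refine ext_mulVec fun x ↦ ?_
  simp only [Submonoid.coe_mul, ← mulVec_mulVec, transvection_mulVec, mulVec_add, mulVec_smul,
    J_mulVec_mulVec_dotProduct_mulVec]

/-- A vector space is not the union of two hyperplanes, even over `𝔽_2`. -/
theorem exists_dotProduct_ne_zero₂ {n F : Type*} [Fintype n] [DecidableEq n] [Field F]
    {a b : n → F} (ha : a ≠ 0) (hb : b ≠ 0) : ∃ x, a ⬝ᵥ x ≠ 0 ∧ b ⬝ᵥ x ≠ 0 := by
  obtain ⟨i, hi⟩ := Function.ne_iff.1 ha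
  obtain ⟨j, hj⟩ := Function.ne_iff.1 hb
  simp only [Pi.zero_apply] at hi hj
  by_cases hbi : b i = 0
  · by_cases haj : a j = 0
    · exact ⟨Pi.single i 1 + Pi.single j 1, by simp [*], by simp [*]⟩
    · exact ⟨Pi.single j 1, by simp [*], by simp [*]⟩
  · exact ⟨Pi.single i 1, by simp [*], by simp [*]⟩

variable (l R) in
/-- The subgroup generated by the transvections with parameter in `R c`. -/
def transvectionSubgroup (c : R) : Subgroup (symplecticGroup l R) :=
  Subgroup.closure {A | ∃ v t, A = transvection v (c * t)}

theorem transvection_mem_transvectionSubgroup (c : R) (v : l ⊕ l → R) (t : R) :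
    transvection v (c * t) ∈ transvectionSubgroup l R c :=
  Subgroup.subset_closure ⟨v, t, rfl⟩

theorem transvection_mem_transvectionSubgroup_one (v : l ⊕ l → R) (t : R) :
    transvection v t ∈ transvectionSubgroup l R 1 := by
  simpa using transvection_mem_transvectionSubgroup 1 v t

end Transvection

/-! ### Generation by transvections and transitivity over a field -/

section Field

variable {l F : Type*} [DecidableEq l] [Fintype l] [Field F]

theorem J_mulVec_ne_zero {v : l ⊕ l → F} (hv : v ≠ 0) : J l F *ᵥ v ≠ 0 := by
  intro h
  have := J_mulVec_J_mulVec v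
  rw [h, mulVec_zero, eq_comm, neg_eq_zero] at this
  exact hv this

theorem transvection_sub_mulVec {x y : l ⊕ l → F} (h : (J l F *ᵥ y) ⬝ᵥ x ≠ 0) :
    (transvection (y - x) ((J l F *ᵥ y) ⬝ᵥ x)⁻¹).1 *ᵥ x = y := by
  rw [transvection_mulVec, mulVec_sub, sub_dotProduct, J_mulVec_dotProduct_self, sub_zero,
    inv_mul_cancel₀ h, one_smul]
  abel

theorem exists_mulVec_eq {x y : l ⊕ l → F} (hx : x ≠ 0) (hy : y ≠ 0) :
    ∃ A : symplecticGroup l F, A.1 *ᵥ x = y := by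
  obtain ⟨z, hxz, hyz⟩ := exists_dotProduct_ne_zero₂ (J_mulVec_ne_zero hx) (J_mulVec_ne_zero hy)
  rw [J_mulVec_dotProduct_comm, neg_ne_zero] at hxz
  exact ⟨transvection (y - z) _ * transvection (z - x) _, by
    rw [Submonoid.coe_mul, ← mulVec_mulVec, transvection_sub_mulVec hxz,
      transvection_sub_mulVec hyz]⟩

/-- The vectors fixed by a symplectic matrix. -/
def fixedVectors (A : symplecticGroup l F) : Submodule F (l ⊕ l → F) :=
  LinearMap.eqLocus A.1.mulVecLin LinearMap.id

theorem mem_fixedVectors {A : symplecticGroup l F} {x : l ⊕ l → F} :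
    x ∈ fixedVectors A ↔ A.1 *ᵥ x = x := Iff.rfl

theorem J_mulVec_sub_dotProduct_of_mem_fixedVectors {A : symplecticGroup l F} {x y : l ⊕ l → F}
    (hy : y ∈ fixedVectors A) : (J l F *ᵥ (x - A.1 *ᵥ x)) ⬝ᵥ y = 0 := by
  rw [mem_fixedVectors] at hy
  have := J_mulVec_mulVec_dotProduct_mulVec A x y
  rw [hy] at this
  rw [mulVec_sub, sub_dotProduct, this, sub_self]

theorem fixedVectors_le_transvection_mul (A : symplecticGroup l F) (x : l ⊕ l → F) (t : F) :
    fixedVectors A ≤ fixedVectors (transvection (x - A.1 *ᵥ x) t * A) := by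
  intro y hy
  have h := J_mulVec_sub_dotProduct_of_mem_fixedVectors (x := x) hy
  rw [mem_fixedVectors] at hy ⊢
  rw [Submonoid.coe_mul, ← mulVec_mulVec, hy, transvection_mulVec, h, mul_zero, zero_smul,
    add_zero]

theorem fixedVectors_lt_transvection_mul {A : symplecticGroup l F} {x : l ⊕ l → F}
    (h : (J l F *ᵥ x) ⬝ᵥ (A.1 *ᵥ x) ≠ 0) :
    fixedVectors A <
      fixedVectors (transvection (x - A.1 *ᵥ x) ((J l F *ᵥ x) ⬝ᵥ (A.1 *ᵥ x))⁻¹ * A) := by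
  refine (SetLike.lt_iff_le_and_exists).2 ⟨fixedVectors_le_transvection_mul A x _, x, ?_, ?_⟩
  · rw [mem_fixedVectors, Submonoid.coe_mul, ← mulVec_mulVec, transvection_sub_mulVec h]
  · intro hx
    rw [mem_fixedVectors] at hx
    rw [hx, J_mulVec_dotProduct_self] at h
    exact h rfl

/-- The symplectic group of a field is generated by transvections. -/
theorem mem_transvectionSubgroup_one (A : symplecticGroup l F) :
    A ∈ transvectionSubgroup l F 1 := by
  suffices h : ∀ (W : Submodule F (l ⊕ l → F)) (A : symplecticGroup l F),
      fixedVectors A = W → A ∈ transvectionSubgroup l F 1 from h _ A rfl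
  intro W
  -- Induction on the fixed space, larger spaces first: when `ω(x, A x) ≠ 0`, the transvection
  -- taking `A x` to `x` enlarges it.
  induction W using WellFoundedGT.induction with
  | ind W ih =>
  rintro A rfl
  have key : ∀ B : symplecticGroup l F, fixedVectors A ≤ fixedVectors B →
      (∃ x, (J l F *ᵥ x) ⬝ᵥ (B.1 *ᵥ x) ≠ 0) → B ∈ transvectionSubgroup l F 1 := by
    rintro B hB ⟨x, hx⟩
    exact ((transvectionSubgroup l F 1).mul_mem_cancel_left
      (transvection_mem_transvectionSubgroup_one _ _)).1
      (ih _ (hB.trans_lt (fixedVectors_lt_transvection_mul hx)) _ rfl)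
  by_cases hA : ∃ x, (J l F *ᵥ x) ⬝ᵥ (A.1 *ᵥ x) ≠ 0
  · exact key A le_rfl hA
  by_cases h1 : A = 1
  · exact h1 ▸ one_mem _
  push Not at hA
  obtain ⟨y, hy⟩ : ∃ y, y - A.1 *ᵥ y ≠ 0 := by
    by_contra! h
    exact h1 (ext_mulVec fun x ↦ by simpa [sub_eq_zero, eq_comm] using h x)
  -- If `ω(x, A x)` vanishes identically, a transvection along `w` loses no fixed vector and makes
  -- the form `ω(w, A x) ω(x, w)`, nonzero for `x` off two hyperplanes.
  set w := y - A.1 *ᵥ y with hw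
  have hAw : A.1 *ᵥ (A⁻¹.1 *ᵥ w) = w := by
    rw [mulVec_mulVec, ← Submonoid.coe_mul, mul_inv_cancel, Submonoid.coe_one, one_mulVec]
  have hw' : A⁻¹.1 *ᵥ w ≠ 0 := by
    intro h
    rw [h, mulVec_zero] at hAw
    exact hy hAw.symm
  obtain ⟨x, hx, hx'⟩ := exists_dotProduct_ne_zero₂ (J_mulVec_ne_zero hy) (J_mulVec_ne_zero hw')
  have hx'' : (J l F *ᵥ w) ⬝ᵥ (A.1 *ᵥ x) ≠ 0 := by
    rwa [← J_mulVec_mulVec_dotProduct_mulVec A, hAw] at hx'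
  refine ((transvectionSubgroup l F 1).mul_mem_cancel_left
      (transvection_mem_transvectionSubgroup_one w 1)).1
      (key _ (fixedVectors_le_transvection_mul A y 1) ⟨x, ?_⟩)
  rw [Submonoid.coe_mul, ← mulVec_mulVec, transvection_mulVec, dotProduct_add, hA, zero_add,
    dotProduct_smul, one_mul, smul_eq_mul, J_mulVec_dotProduct_comm x w]
  exact mul_ne_zero hx'' (neg_ne_zero.2 hx)

end Field

end SymplecticGroup

/-! ### Congruence kernels and the factorization criterion -/

namespace ZMod

theorem castHom_eq_zero_iff_exists {m q : ℕ} [NeZero q] (h : m ∣ q) (a : ZMod q) :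
    castHom h (ZMod m) a = 0 ↔ ∃ b, a = m * b := by
  constructor
  · intro ha
    rw [← natCast_zmod_val a, map_natCast, natCast_eq_zero_iff] at ha
    obtain ⟨k, hk⟩ := ha
    exact ⟨k, by rw [← natCast_zmod_val a, hk, Nat.cast_mul]⟩
  · rintro ⟨b, rfl⟩
    rw [map_mul, map_natCast, natCast_self, zero_mul]

theorem natCast_mul_eq_of_castHom_eq {p m q : ℕ} [NeZero q] (hq : q = p * m) (h : p ∣ q)
    {a b : ZMod q} (hab : castHom h (ZMod p) a = castHom h (ZMod p) b) :
    (m : ZMod q) * a = m * b := by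
  rw [← sub_eq_zero, ← map_sub, castHom_eq_zero_iff_exists] at hab
  obtain ⟨c, hc⟩ := hab
  have : (m : ZMod q) * p = 0 := by
    rw [← Nat.cast_mul, mul_comm, ← hq, natCast_self]
  rw [← sub_eq_zero, ← mul_sub, hc, ← mul_assoc, this, zero_mul]

end ZMod

namespace SymplecticGroup

open Matrix

theorem isSymm_mem_addSubmonoid {n R : Type*} [Fintype n] [DecidableEq n] [CommRing R]
    (S : AddSubmonoid (Matrix n n R)) (hS : ∀ (v : n → R) (t : R), t • vecMulVec v v ∈ S)
    {X : Matrix n n R} (hX : X.IsSymm) : X ∈ S := by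
  let e := Fintype.equivFin n
  -- The strict upper triangle counts each off-diagonal pair once, so no division by 2 is needed.
  let U : Matrix n n R := Matrix.of fun i j ↦ if e i < e j then X i j else 0
  have hdiag : ∀ i t, single i i t ∈ S := fun i t ↦ by
    convert hS (Pi.single i 1) t using 1
    rw [← single_eq_single_vecMulVec_single, smul_single, smul_eq_mul, mul_one]
  have hU : X = ∑ i, single i i (X i i) + ∑ i, ∑ j, (single i j (U i j) + single j i (U i j)) := by
    have h1 : ∑ i, ∑ j, single j i (U i j) = Uᵀ := by
      rw [Finset.sum_comm]
      exact (matrix_eq_sum_single Uᵀ).symm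
    simp only [Finset.sum_add_distrib]
    rw [← matrix_eq_sum_single U, h1]
    ext i j
    have h2 : (∑ k, single k k (X k k)) i j = if i = j then X i i else 0 := by
      rw [Matrix.sum_apply]
      simp only [single_apply]
      split_ifs with hij
      · subst hij; simp
      · exact Finset.sum_eq_zero fun k _ ↦ if_neg fun h ↦ hij (h.1.symm.trans h.2)
    rw [Matrix.add_apply, h2, Matrix.add_apply, transpose_apply]
    rcases lt_trichotomy (e i) (e j) with h | h | h
    · have : i ≠ j := fun h' ↦ by simp [h'] at h
      simp [U, h, this, h.not_gt]
    · obtain rfl := e.injective h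
      simp [U]
    · have : i ≠ j := fun h' ↦ by simp [h'] at h
      simp [U, h, this, h.not_gt, hX.apply i j]
  rw [hU]
  refine add_mem (sum_mem fun i _ ↦ hdiag _ _) (sum_mem fun i _ ↦ sum_mem fun j _ ↦ ?_)
  have : single i j (U i j) + single j i (U i j) =
      U i j • vecMulVec (Pi.single i 1 + Pi.single j 1) (Pi.single i 1 + Pi.single j 1) +
        (single i i (-U i j) + single j j (-U i j)) := by
    simp only [add_vecMulVec, vecMulVec_add, ← single_eq_single_vecMulVec_single, smul_add,
      smul_single, smul_eq_mul, mul_one, ← single_neg]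
    abel
  rw [this]
  exact add_mem (hS _ _) (add_mem (hdiag _ _) (hdiag _ _))

/-- As `c ^ 2 = 0`, multiplying matrices `1 + c N` adds the `N`, and being symplectic becomes
linear: `c N J` is symmetric. Symmetric matrices are sums of `t v vᵀ`, which correspond to
transvections. -/
theorem mem_transvectionSubgroup_of_sq_eq_zero {l R : Type*} [DecidableEq l] [Fintype l]
    [CommRing R] {c : R} (hc : c ^ 2 = 0) (A : symplecticGroup l R)
    (hA : ∀ i j, c ∣ (A.1 - 1) i j) : A ∈ transvectionSubgroup l R c := by
  have hNN : ∀ M N : Matrix (l ⊕ l) (l ⊕ l) R, (c • M) * (c • N) = 0 := fun M N ↦ by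
    rw [smul_mul_smul_comm, ← sq, hc, zero_smul]
  let S : AddSubmonoid (Matrix (l ⊕ l) (l ⊕ l) R) :=
    { carrier := {X | ∃ B ∈ transvectionSubgroup l R c, B.1 = 1 - c • (X * J l R)}
      zero_mem' := ⟨1, one_mem _, by simp⟩
      add_mem' := by
        rintro X Y ⟨B, hB, hB'⟩ ⟨C, hC, hC'⟩
        refine ⟨B * C, mul_mem hB hC, ?_⟩
        rw [Submonoid.coe_mul, hB', hC', sub_mul, one_mul, mul_sub, mul_one, hNN, add_mul, smul_add]
        abel }
  have hS : ∀ (v : l ⊕ l → R) (t : R), t • vecMulVec v v ∈ S := fun v t ↦ by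
    refine ⟨transvection v (c * t), transvection_mem_transvectionSubgroup c v t, ?_⟩
    rw [coe_transvection, ← vecMulVec_J_mulVec_mul_J, smul_mul_assoc, mul_assoc, J_squared,
      mul_neg, mul_one, smul_neg, smul_neg, sub_neg_eq_add, smul_smul]
  have hN : ∃ N : Matrix (l ⊕ l) (l ⊕ l) R, A.1 = 1 + c • N := by
    choose f hf using hA
    exact ⟨Matrix.of f, by ext i j; simp [← hf i j]⟩
  obtain ⟨N, hN⟩ := hN
  have hsymm : (c • (N * J l R)).IsSymm := by
    have h := mem_iff.1 A.2
    have h0 : c • N * J l R * (c • N)ᵀ = 0 := by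
      rw [smul_mul_assoc, transpose_smul, hNN]
    rw [hN, transpose_add, transpose_one, add_mul, one_mul, mul_add, mul_one, add_mul, h0,
      add_zero, add_assoc, add_eq_left] at h
    rw [IsSymm, transpose_smul, transpose_mul, J_transpose, neg_mul, smul_neg, ← mul_smul_comm,
      ← transpose_smul, neg_eq_iff_add_eq_zero, add_comm, ← smul_mul_assoc]
    exact h
  -- Only `c N J` is known to be symmetric, not `N J`. Dividing by `c` through a fixed choice
  -- function, entry by entry, preserves the symmetry.
  let f : R → R := fun s ↦ Classical.epsilon fun x ↦ c * x = s
  let X : Matrix (l ⊕ l) (l ⊕ l) R := (c • (N * J l R)).map f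
  have hcX : c • X = c • (N * J l R) := by
    ext i j
    exact Classical.epsilon_spec (p := fun x ↦ c * x = (c • (N * J l R)) i j) ⟨_, rfl⟩
  obtain ⟨B, hB, hB'⟩ := isSymm_mem_addSubmonoid S hS (hsymm.map f : X.IsSymm)
  convert hB
  apply Subtype.ext
  rw [hN, hB', ← smul_mul_assoc]
  change _ = 1 - c • X * J l R
  rw [hcX, smul_mul_assoc, mul_assoc, J_squared]
  simp

end SymplecticGroup

namespace SpMod

open Matrix hiding transvection
open SymplecticGroup

variable {g : ℕ}

theorem reduction_mulVec {m q : ℕ} (h : m ∣ q) (A : SpMod g q) (v : Fin g ⊕ Fin g → ZMod q) :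
    (reduction g h A).1 *ᵥ (ZMod.castHom h (ZMod m) ∘ v) =
      ZMod.castHom h (ZMod m) ∘ (A.1 *ᵥ v) := by
  ext i
  exact (RingHom.map_mulVec (ZMod.castHom h (ZMod m)) A.1 v i).symm

theorem reduction_transvection {m q : ℕ} (h : m ∣ q) (v : Fin g ⊕ Fin g → ZMod q) (t : ZMod q) :
    reduction g h (transvection v t) =
      transvection (ZMod.castHom h (ZMod m) ∘ v) (ZMod.castHom h (ZMod m) t) := by
  have hJ : ZMod.castHom h (ZMod m) ∘ (J (Fin g) (ZMod q) *ᵥ v) =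
      J (Fin g) (ZMod m) *ᵥ (ZMod.castHom h (ZMod m) ∘ v) := by
    rw [← map_J (Fin g) (ZMod.castHom h (ZMod m))]
    ext i
    exact RingHom.map_mulVec (ZMod.castHom h (ZMod m)) _ v i
  apply Subtype.ext
  ext i j
  rw [coe_transvection, ← hJ]
  change ZMod.castHom h (ZMod m) ((1 + t • vecMulVec v (J (Fin g) (ZMod q) *ᵥ v)) i j) = _
  simp only [Matrix.add_apply, Matrix.smul_apply, smul_eq_mul, vecMulVec_apply, map_add, map_mul,
    Function.comp_apply, add_left_inj]
  rw [Matrix.one_apply, Matrix.one_apply, apply_ite (ZMod.castHom h (ZMod m)), map_one, map_zero]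

theorem reduction_eq_one_iff {m q : ℕ} [NeZero q] (h : m ∣ q) (A : SpMod g q) :
    reduction g h A = 1 ↔ ∀ i j, (m : ZMod q) ∣ (A.1 - 1) i j := by
  have : ∀ i j, (m : ZMod q) ∣ (A.1 - 1) i j ↔
      (reduction g h A).1 i j = (1 : Matrix _ _ (ZMod m)) i j := fun i j ↦ by
    rw [← sub_eq_zero, Dvd.dvd.eq_def]
    change (∃ b, _ = _ * b) ↔ _
    rw [← ZMod.castHom_eq_zero_iff_exists h]
    rw [Matrix.sub_apply, map_sub, Matrix.one_apply, Matrix.one_apply,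
      apply_ite (ZMod.castHom h (ZMod m)), map_one, map_zero]
    rfl
  simp only [this]
  exact ⟨fun h i j ↦ by rw [h]; rfl, fun h ↦ Subtype.ext (Matrix.ext h)⟩

theorem transvectionSubgroup_le_ker_reduction {m q : ℕ} (h : m ∣ q) :
    transvectionSubgroup (Fin g) (ZMod q) m ≤ (reduction g h).ker := by
  rw [transvectionSubgroup, Subgroup.closure_le]
  rintro _ ⟨v, t, rfl⟩
  rw [SetLike.mem_coe, MonoidHom.mem_ker, reduction_transvection, map_mul, map_natCast,
    ZMod.natCast_self, zero_mul, SymplecticGroup.transvection_zero]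

/-- Since `m` is invertible modulo `p`, parameters divisible by `m` still reach every transvection
over `𝔽_p`. -/
theorem exists_mem_transvectionSubgroup_reduction_eq {p m q : ℕ} [Fact p.Prime]
    (h : p ∣ q) (hpm : ¬ p ∣ m) (B : SpMod g p) :
    ∃ A ∈ transvectionSubgroup (Fin g) (ZMod q) m, reduction g h A = B := by
  suffices hle : transvectionSubgroup (Fin g) (ZMod p) 1 ≤
      (transvectionSubgroup (Fin g) (ZMod q) m).map (reduction g h) from
    hle (mem_transvectionSubgroup_one B)
  rw [transvectionSubgroup, Subgroup.closure_le]
  rintro _ ⟨v, t, rfl⟩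
  have hm : (m : ZMod p) ≠ 0 := by rwa [Ne, ZMod.natCast_eq_zero_iff]
  choose w hw using fun i ↦ ZMod.castHom_surjective h (v i)
  obtain ⟨s, hs⟩ := ZMod.castHom_surjective h ((m : ZMod p)⁻¹ * t)
  refine ⟨_, transvection_mem_transvectionSubgroup (m : ZMod q) w s, ?_⟩
  rw [reduction_transvection, map_mul, map_natCast, hs, mul_inv_cancel_left₀ hm, one_mul]
  rw [show ZMod.castHom h _ ∘ w = v from funext hw]

/-- If `p ∣ m`, then `m ^ 2 = 0` modulo `q` and the linearized case applies. Otherwise `A` is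
corrected by a product of such transvections to be 1 modulo both `p` and `m`, hence modulo `q`. -/
theorem mem_transvectionSubgroup_of_reduction_eq_one {p m q : ℕ} [NeZero q] [Fact p.Prime]
    (hq : q = p * m) (h : m ∣ q) {A : SpMod g q} (hA : reduction g h A = 1) :
    A ∈ transvectionSubgroup (Fin g) (ZMod q) m := by
  by_cases hpm : p ∣ m
  · refine mem_transvectionSubgroup_of_sq_eq_zero ?_ A ((reduction_eq_one_iff h A).1 hA)
    rw [← Nat.cast_pow, ZMod.natCast_eq_zero_iff, hq, sq]
    exact mul_dvd_mul_right hpm m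
  · have hp : p ∣ q := hq ▸ dvd_mul_right p m
    obtain ⟨B, hB, hBA⟩ :=
      exists_mem_transvectionSubgroup_reduction_eq hp hpm (reduction g hp A)
    have h1 : reduction g h (A * B⁻¹) = 1 := by
      rw [map_mul, hA, one_mul, map_inv,
        (MonoidHom.mem_ker).1 (transvectionSubgroup_le_ker_reduction h hB), inv_one]
    have h2 : reduction g hp (A * B⁻¹) = 1 := by
      rw [map_mul, map_inv, hBA, mul_inv_cancel]
    rw [reduction_eq_one_iff] at h1 h2
    have h3 : A * B⁻¹ = 1 := by
      refine Subtype.ext (Matrix.ext fun i j ↦ ?_)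
      rw [← sub_eq_zero]
      change ((A * B⁻¹).1 - 1) i j = 0
      have hcop : IsCoprime (p : ZMod q) m := by
        simpa using (Nat.isCoprime_iff_coprime.2
          (((Fact.out : p.Prime).coprime_iff_not_dvd).2 hpm)).map (Int.castRingHom (ZMod q))
      have := hcop.mul_dvd (h2 i j) (h1 i j)
      rwa [← Nat.cast_mul, ← hq, ZMod.natCast_self, zero_dvd_iff] at this
    rwa [mul_inv_eq_one.1 h3]

theorem transvectionSubgroup_le_range_reduction {m q : ℕ} (h : m ∣ q) :
    transvectionSubgroup (Fin g) (ZMod m) 1 ≤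
      (transvectionSubgroup (Fin g) (ZMod q) 1).map (reduction g h) := by
  rw [transvectionSubgroup, Subgroup.closure_le]
  rintro _ ⟨v, t, rfl⟩
  choose w hw using fun i ↦ ZMod.castHom_surjective h (v i)
  obtain ⟨s, hs⟩ := ZMod.castHom_surjective h t
  refine ⟨_, transvection_mem_transvectionSubgroup_one w s, ?_⟩
  rw [reduction_transvection, hs, one_mul]
  rw [show ZMod.castHom h _ ∘ w = v from funext hw]

theorem transvectionSubgroup_one_eq_top (q : ℕ) [hq : NeZero q] :
    transvectionSubgroup (Fin g) (ZMod q) 1 = ⊤ := by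
  induction q using induction_on_primes generalizing hq with
  | zero => exact absurd rfl hq.out
  | one =>
    rw [eq_top_iff]
    intro A _
    rw [show A = 1 from Subtype.ext (Matrix.ext fun _ _ ↦ Subsingleton.elim _ _)]
    exact one_mem _
  | prime_mul p m hp ih =>
    have : Fact p.Prime := ⟨hp⟩
    have : NeZero m := ⟨fun h ↦ hq.out (by rw [h, mul_zero])⟩
    rw [eq_top_iff]
    intro A _
    have h : m ∣ p * m := dvd_mul_left m p
    obtain ⟨B, hB, hBA⟩ := transvectionSubgroup_le_range_reduction h
      (ih ▸ Subgroup.mem_top (reduction g h A))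
    have hle : transvectionSubgroup (Fin g) (ZMod (p * m)) m ≤ transvectionSubgroup _ _ 1 := by
      rw [transvectionSubgroup, Subgroup.closure_le]
      rintro _ ⟨v, t, rfl⟩
      exact transvection_mem_transvectionSubgroup_one _ _
    have : A * B⁻¹ ∈ transvectionSubgroup (Fin g) (ZMod (p * m)) m :=
      mem_transvectionSubgroup_of_reduction_eq_one rfl h
        (by rw [map_mul, map_inv, hBA, mul_inv_cancel])
    simpa using mul_mem (hle this) hB

theorem reduction_surjective {m q : ℕ} [NeZero q] (h : m ∣ q) :
    Function.Surjective (reduction g h) := by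
  have : NeZero m := ⟨fun h' ↦ NeZero.ne q (by rwa [h', zero_dvd_iff] at h)⟩
  intro B
  obtain ⟨A, -, hA⟩ := transvectionSubgroup_le_range_reduction h
    (transvectionSubgroup_one_eq_top (g := g) m ▸ Subgroup.mem_top B)
  exact ⟨A, hA⟩

/-- Multiplication by `m` modulo `p * m` sees only residues modulo `p`. -/
theorem transvection_eq_of_comp_castHom_eq {p m q : ℕ} [NeZero q] (hq : q = p * m) (h : p ∣ q)
    {v w : Fin g ⊕ Fin g → ZMod q}
    (hvw : ZMod.castHom h (ZMod p) ∘ v = ZMod.castHom h (ZMod p) ∘ w) (t : ZMod q) :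
    transvection v (m * t) = transvection w (m * t) := by
  have key : reduction g h (transvection v t) = reduction g h (transvection w t) := by
    rw [reduction_transvection, reduction_transvection, hvw]
  refine Subtype.ext (Matrix.ext fun i j ↦ ?_)
  have hij := congrArg (fun A ↦ A.1 i j) key
  have := ZMod.natCast_mul_eq_of_castHom_eq hq h hij
  rw [coe_transvection, coe_transvection] at this ⊢
  simp only [Matrix.add_apply, mul_add, Matrix.smul_apply, smul_eq_mul, add_right_inj,
    mul_assoc] at this ⊢
  exact this

/-- Only `v` modulo `p` matters. If it is nonzero, some lifted symplectic matrix carries `e` to it,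
and conjugation and powers give all parameters. -/
theorem transvectionSubgroup_le_of_normal {p m q : ℕ} [NeZero q] [Fact p.Prime]
    (hq : q = p * m) {e : Fin g ⊕ Fin g → ZMod q}
    (he : ZMod.castHom (hq ▸ dvd_mul_right p m : p ∣ q) (ZMod p) ∘ e ≠ 0)
    (M : Subgroup (SpMod g q)) [M.Normal] (hM : transvection e (m : ZMod q) ∈ M) :
    transvectionSubgroup (Fin g) (ZMod q) m ≤ M := by
  have h : p ∣ q := hq ▸ dvd_mul_right p m
  rw [transvectionSubgroup, Subgroup.closure_le]
  rintro _ ⟨v, t, rfl⟩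
  by_cases hv : ZMod.castHom h (ZMod p) ∘ v = 0
  · rw [transvection_eq_of_comp_castHom_eq hq h (w := 0)
      (hv.trans (funext fun _ ↦ (map_zero _).symm))]
    have h0 : transvection (0 : Fin g ⊕ Fin g → ZMod q) (m * t) = 1 := by
      refine Subtype.ext ?_
      rw [coe_transvection, zero_vecMulVec, smul_zero, add_zero]
      rfl
    rw [SetLike.mem_coe, h0]
    exact one_mem M
  · obtain ⟨B, hB⟩ := exists_mulVec_eq he hv
    obtain ⟨A, rfl⟩ := reduction_surjective h B
    rw [reduction_mulVec] at hB
    rw [SetLike.mem_coe, ← transvection_eq_of_comp_castHom_eq hq h hB, ← conj_transvection]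
    refine ‹M.Normal›.conj_mem _ ?_ A
    have : transvection e ((m : ZMod q) * t) = transvection e (m : ZMod q) ^ t.val := by
      conv_lhs => rw [← ZMod.natCast_zmod_val t, ← Nat.cast_mul]
      rw [transvection_natCast, transvection_natCast, pow_mul]
    rw [this]
    exact pow_mem hM _

theorem factorsThrough_of_transvection_eq_one {p m q : ℕ} [NeZero q] [Fact p.Prime]
    (hq : q = p * m) (hm : m ∣ q) {e : Fin g ⊕ Fin g → ZMod q}
    (he : ZMod.castHom (hq ▸ dvd_mul_right p m : p ∣ q) (ZMod p) ∘ e ≠ 0)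
    {V : Type*} [AddCommGroup V] [Module ℂ V] (ρ : Representation ℂ (SpMod g q) V)
    (hρ : ρ (transvection e (m : ZMod q)) = 1) : FactorsThrough ρ m hm := by
  have hker : (reduction g hm).ker ≤ ρ.ker := fun A hA ↦
    transvectionSubgroup_le_of_normal hq he ρ.ker hρ
      (mem_transvectionSubgroup_of_reduction_eq_one hq hm hA)
  have hinv := Function.rightInverse_surjInv (reduction_surjective (g := g) hm)
  have key : ∀ A B : SpMod g q, reduction g hm A = reduction g hm B → ρ A = ρ B := by
    intro A B hAB
    have h1 : A * B⁻¹ ∈ ρ.ker := hker (by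
      rw [MonoidHom.mem_ker, map_mul, map_inv, hAB, mul_inv_cancel])
    rw [MonoidHom.mem_ker] at h1
    calc ρ A = ρ (A * B⁻¹ * B) := by rw [inv_mul_cancel_right]
      _ = ρ B := by rw [map_mul, h1, one_mul]
  refine ⟨{ toFun := fun B ↦ ρ (Function.surjInv (reduction_surjective hm) B)
            map_one' := ?_
            map_mul' := fun B C ↦ ?_ }, MonoidHom.ext fun A ↦ ?_⟩
  · rw [← map_one ρ]
    exact key _ _ ((hinv _).trans (map_one _).symm)
  · rw [← map_mul]
    exact key _ _ (by rw [map_mul, hinv, hinv, hinv])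
  · exact key _ _ (hinv _).symm

end SpMod

/-! ### Irreducible representations -/

namespace Representation

variable {k G V : Type*} [Field k] [Group G] [AddCommGroup V] [Module k V]
  {ρ : Representation k G V}

theorem IsIrreducible.eq_bot_or_eq_top_of_invariant (hρ : ρ.IsIrreducible) (W : Submodule k V)
    (hW : ∀ (g : G) ⦃v : V⦄, v ∈ W → ρ g v ∈ W) : W = ⊥ ∨ W = ⊤ := by
  rcases hρ.eq_bot_or_eq_top ⟨W, hW⟩ with h | h
  · exact Or.inl (congrArg Subrepresentation.toSubmodule h)
  · exact Or.inr (congrArg Subrepresentation.toSubmodule h)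

theorem IsIrreducible.nontrivial_space (hρ : ρ.IsIrreducible) : Nontrivial V := by
  by_contra h
  rw [not_nontrivial_iff_subsingleton] at h
  obtain ⟨W₁, W₂, hW⟩ := hρ.exists_pair_ne
  exact hW (Subrepresentation.toSubmodule_injective (Subsingleton.elim _ _))

/-- Any nonzero orbit is finite and spans. This matters because `finrank` is 0 in infinite
dimension. -/
theorem IsIrreducible.finiteDimensional [Finite G] (hρ : ρ.IsIrreducible) :
    FiniteDimensional k V := by
  have := hρ.nontrivial_space
  obtain ⟨v, hv⟩ := exists_ne (0 : V)
  have hspan : ∀ (g : G) ⦃w : V⦄, w ∈ Submodule.span k (Set.range fun h ↦ ρ h v) →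
      ρ g w ∈ Submodule.span k (Set.range fun h ↦ ρ h v) := by
    intro g w hw
    induction hw using Submodule.span_induction with
    | mem w hw =>
      obtain ⟨h, rfl⟩ := hw
      exact Submodule.subset_span ⟨g * h, by simp⟩
    | zero => simp
    | add x y _ _ hx hy => rw [map_add]; exact add_mem hx hy
    | smul a x _ hx => rw [map_smul]; exact Submodule.smul_mem _ a hx
  rcases hρ.eq_bot_or_eq_top_of_invariant _ hspan with h | h
  · refine absurd ?_ hv
    rw [← Submodule.mem_bot k, ← h]
    exact Submodule.subset_span ⟨1, by simp⟩
  · exact ⟨h ▸ Submodule.fg_span (Set.finite_range _)⟩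

/-- The common kernel of all `x * ρ g` is invariant and contains the image of `y`. -/
theorem IsIrreducible.eq_zero_or_eq_zero (hρ : ρ.IsIrreducible) {x y : Module.End k V}
    (hxy : ∀ g, x * ρ g * y = 0) : x = 0 ∨ y = 0 := by
  let W : Submodule k V := ⨅ g, LinearMap.ker (x * ρ g)
  have hW : ∀ w, w ∈ W ↔ ∀ g, x (ρ g w) = 0 := fun w ↦ by simp [W]
  rcases hρ.eq_bot_or_eq_top_of_invariant W (fun g w hw ↦ by
    rw [hW] at hw ⊢
    intro h
    simpa using hw (h * g)) with h | h
  · right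
    ext v
    have : y v ∈ W := (hW _).2 fun g ↦ LinearMap.congr_fun (hxy g) v
    rwa [h, Submodule.mem_bot] at this
  · left
    ext v
    simpa using (hW v).1 (h ▸ Submodule.mem_top) 1

end Representation

/-! ### Chinese remainder splitting and an eigenvalue of exact order -/

namespace SymplecticGroup

open Matrix

variable {l R : Type*} [DecidableEq l] [Fintype l] [CommRing R]

/-- The component at an idempotent `ε` of a symplectic matrix. -/
def idempotentPart {ε : R} (hε : IsIdempotentElem ε) (A : symplecticGroup l R) :
    symplecticGroup l R :=
  ⟨1 + ε • (A.1 - 1), by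
    have h := mem_iff.1 A.2
    obtain ⟨N, hN⟩ : ∃ N, A.1 = 1 + N := ⟨A.1 - 1, by abel⟩
    rw [hN, transpose_add, transpose_one, add_mul, one_mul, mul_add, mul_one, add_mul,
      add_assoc, add_eq_left] at h
    rw [mem_iff, hN, add_sub_cancel_left, transpose_add, transpose_one, transpose_smul, add_mul,
      one_mul, mul_add, mul_one, add_mul, smul_mul_assoc, smul_mul_assoc, mul_smul_comm,
      mul_smul_comm, smul_smul, hε.eq, add_assoc, add_eq_left, ← smul_add, ← smul_add, h,
      smul_zero]⟩

theorem idempotentPart_mul_idempotentPart {ε δ : R} (hε : IsIdempotentElem ε)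
    (hδ : IsIdempotentElem δ) (h : ε + δ = 1) (h0 : ε * δ = 0) (A : symplecticGroup l R) :
    idempotentPart hε A * idempotentPart hδ A = A := by
  refine Subtype.ext ?_
  change (1 + ε • (A.1 - 1)) * (1 + δ • (A.1 - 1)) = A.1
  rw [mul_add, mul_one, add_mul, one_mul, smul_mul_smul_comm, h0, zero_smul, add_zero, add_assoc,
    ← add_smul, h, one_smul, add_sub_cancel]

theorem commute_idempotentPart_transvection {ε c : R} (hε : IsIdempotentElem ε) (h : ε * c = 0)
    (A : symplecticGroup l R) (v : l ⊕ l → R) (t : R) :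
    Commute (idempotentPart hε A) (transvection v (c * t)) := by
  refine Subtype.ext ?_
  have h1 : ε * (c * t) = 0 := by rw [← mul_assoc, h, zero_mul]
  change (1 + ε • (A.1 - 1)) * (1 + (c * t) • vecMulVec v (J l R *ᵥ v)) =
    (1 + (c * t) • vecMulVec v (J l R *ᵥ v)) * (1 + ε • (A.1 - 1))
  have h2 : c * t * ε = 0 := by rw [mul_comm, h1]
  simp only [add_mul, mul_add, smul_mul_smul_comm, h1, h2, one_mul, mul_one, zero_smul, add_zero]
  abel

/-- If `x a + y b = 1`, then `y b` and `x a` are complementary idempotents killing `a` and `b`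
respectively. -/
theorem exists_mul_eq_and_commute_transvection {a b : R} (hab : a * b = 0) (h : IsCoprime a b)
    (A : symplecticGroup l R) : ∃ B C : symplecticGroup l R, B * C = A ∧
      (∀ v t, Commute B (transvection v (a * t))) ∧
      (∀ v t, Commute C (transvection v (b * t))) := by
  obtain ⟨x, y, hxy⟩ := h
  have h0 : y * b * (x * a) = 0 := by
    linear_combination x * y * hab
  have h1 : IsIdempotentElem (y * b) := by
    rw [IsIdempotentElem]
    linear_combination y * b * hxy - h0
  have h2 : IsIdempotentElem (x * a) := by
    rw [IsIdempotentElem]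
    linear_combination x * a * hxy - h0
  refine ⟨idempotentPart h1 A, idempotentPart h2 A,
    idempotentPart_mul_idempotentPart h1 h2 (by rw [add_comm, hxy]) h0 A,
    commute_idempotentPart_transvection h1 ?_ A, commute_idempotentPart_transvection h2 ?_ A⟩
  · linear_combination y * hab
  · linear_combination x * hab

/-- The symplectic matrix `diag(u, u⁻¹)`. -/
def scalarUnit (u : Rˣ) : symplecticGroup l R :=
  ⟨fromBlocks ((u : R) • 1) 0 0 ((↑u⁻¹ : R) • 1), by
    rw [fromBlocks_mem_iff]
    simp [smul_smul]⟩

theorem scalarUnit_mulVec_inl (u : Rˣ) (x : l → R) :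
    (scalarUnit u).1 *ᵥ Sum.elim x 0 = (u : R) • Sum.elim x (0 : l → R) := by
  change fromBlocks ((u : R) • 1) 0 0 ((↑u⁻¹ : R) • 1) *ᵥ Sum.elim x 0 = _
  rw [fromBlocks_mulVec]
  ext i
  cases i <;> simp [smul_mulVec]

end SymplecticGroup

namespace Module.End

open Polynomial

/-- An operator with `f ^ q = 1` on which no polynomial `∏ (X ^ (q / p) - 1)` over the primes
`p ∣ q` vanishes has an eigenvalue of order `q`. -/
theorem exists_hasEigenvalue_orderOf_eq {K V : Type*} [Field K] [IsAlgClosed K] [CharZero K]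
    [AddCommGroup V] [Module K V] [FiniteDimensional K V] {f : Module.End K V} {q : ℕ}
    (hq : q ≠ 0) (hf : f ^ q = 1)
    (h : aeval f (∏ p ∈ q.primeFactors, (X ^ (q / p) - 1 : K[X])) ≠ 0) :
    ∃ ζ, f.HasEigenvalue ζ ∧ orderOf ζ = q := by
  set F : K[X] := ∏ p ∈ q.primeFactors, (X ^ (q / p) - 1) with hF
  have hF0 : F ≠ 0 := fun h0 ↦ h (by rw [h0, map_zero])
  have hdvd : minpoly K f ∣ X ^ q - 1 := minpoly.dvd K f (by simp [hf])
  have hmin : minpoly K f ≠ 0 := minpoly.ne_zero (Algebra.IsIntegral.isIntegral f)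
  by_contra! hne
  have hndvd : ¬ minpoly K f ∣ F := fun hd ↦ h (by
    obtain ⟨G, hG⟩ := hd
    rw [hG, map_mul, minpoly.aeval, zero_mul])
  rw [IsAlgClosed.dvd_iff_roots_le_roots hmin hF0] at hndvd
  -- Simple roots reduce divisibility of `F` by the minimal polynomial to containment of roots; a
  -- `q`-th root of unity of smaller order satisfies `ζ ^ (q / p) = 1` for some `p`.
  have hsep : (X ^ q - 1 : K[X]).Separable :=
    X_pow_sub_one_separable_iff.2 (Nat.cast_ne_zero.2 hq)
  have hnodup : (minpoly K f).roots.Nodup := nodup_roots (hsep.of_dvd hdvd)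
  refine hndvd ((Multiset.le_iff_subset hnodup).2 fun ζ hζ ↦ ?_)
  have hroot : (minpoly K f).IsRoot ζ := isRoot_of_mem_roots hζ
  have hζq : ζ ^ q = 1 := by
    have := hroot.dvd hdvd
    simpa [sub_eq_zero] using this
  rw [mem_roots hF0]
  by_contra hFζ
  refine hne ζ (hasEigenvalue_of_isRoot hroot)
    (orderOf_eq_of_pow_and_pow_div_prime (Nat.pos_of_ne_zero hq) hζq fun p hp hpq hζ' ↦ hFζ ?_)
  rw [IsRoot, hF, eval_prod]
  exact Finset.prod_eq_zero (Nat.mem_primeFactors.2 ⟨hp, hpq, hq⟩) (by simp [hζ'])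

theorem card_le_finrank_of_hasEigenvalue {K V : Type*} [Field K] [AddCommGroup V] [Module K V]
    [FiniteDimensional K V] {f : Module.End K V} (s : Finset K)
    (hs : ∀ μ ∈ s, f.HasEigenvalue μ) : s.card ≤ Module.finrank K V := by
  choose x hx using fun μ : s ↦ (hs μ.1 μ.2).exists_hasEigenvector
  simpa using
    (f.eigenvectors_linearIndependent' (fun μ : s ↦ μ.1) Subtype.val_injective x
      hx).fintype_card_le_finrank

end Module.End

/-! ### The dimension bound -/

namespace SpMod

open Matrix hiding transvection
open SymplecticGroup Polynomial

variable {g q : ℕ} {V : Type*} [AddCommGroup V] [Module ℂ V]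

/-- Let `x` be the factor at `p` and `y` the product over the other primes. Writing `A = C B` with
`C` commuting with `x` and `B` with `y` gives `x ρ(A) y = ρ(C) x y ρ(B)`, so `x y = 0` would force
`x = 0` or `y = 0`. -/
theorem aeval_prod_primeFactors_ne_zero [NeZero q] {ρ : Representation ℂ (SpMod g q) V}
    (hρ : ρ.IsIrreducible) (e : Fin g ⊕ Fin g → ZMod q)
    (he : ∀ p ∈ q.primeFactors, ρ (transvection e 1) ^ (q / p) ≠ 1) (s : Finset ℕ)
    (hs : s ⊆ q.primeFactors) :
    aeval (ρ (transvection e 1)) (∏ p ∈ s, (X ^ (q / p) - 1 : ℂ[X])) ≠ 0 := by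
  have := hρ.nontrivial_space
  set f : Module.End ℂ V := ρ (transvection e 1) with hf
  have hfn : ∀ n : ℕ, f ^ n = ρ (transvection e (n : ZMod q)) := fun n ↦ by
    rw [hf, ← map_pow, transvection_natCast]
  induction s using Finset.induction_on with
  | empty => simp
  | insert p s hps ih =>
    rw [Finset.insert_subset_iff] at hs
    rw [Finset.prod_insert hps]
    intro h0
    have hp := Nat.mem_primeFactors.1 hs.1
    obtain ⟨k, m, hm, hqm⟩ := Nat.exists_eq_pow_mul_and_not_dvd (NeZero.ne q) p hp.1.ne_one
    have hk : k ≠ 0 := fun hk ↦ hm (by rw [hk, pow_zero, one_mul] at hqm; exact hqm ▸ hp.2.1)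
    have hcop : IsCoprime ((p ^ k : ℕ) : ZMod q) (m : ZMod q) := by
      simpa using (Nat.isCoprime_iff_coprime.2
        (((hp.1.coprime_iff_not_dvd).2 hm).pow_left k)).map (Int.castRingHom (ZMod q))
    have hzero : (m : ZMod q) * ((p ^ k : ℕ) : ZMod q) = 0 := by
      rw [mul_comm, ← Nat.cast_mul, ← hqm, ZMod.natCast_self]
    rw [map_mul] at h0
    suffices key : ∀ A, aeval f (X ^ (q / p) - 1 : ℂ[X]) * ρ A *
        aeval f (∏ p ∈ s, (X ^ (q / p) - 1 : ℂ[X])) = 0 by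
      rcases hρ.eq_zero_or_eq_zero key with h | h
      · refine he p hs.1 ?_
        simpa [sub_eq_zero] using h
      · exact ih hs.2 h
    intro A
    obtain ⟨C, B, rfl, hC, hB⟩ := exists_mul_eq_and_commute_transvection
      (l := Fin g) hzero hcop.symm A
    have hCf : Commute (ρ C) (aeval f (X ^ (q / p) - 1 : ℂ[X])) := by
      have hqp : (q / p : ℕ) = m * p ^ (k - 1) := by
        refine Nat.div_eq_of_eq_mul_right hp.1.pos ?_
        conv_lhs => rw [hqm, ← Nat.succ_pred_eq_of_ne_zero hk, pow_succ]
        rw [Nat.pred_eq_sub_one]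
        ring
      rw [map_sub, map_pow, aeval_X, map_one, hfn, hqp, Nat.cast_mul]
      exact ((hC _ _).map ρ).sub_right (Commute.one_right _)
    have hBf : Commute (ρ B) (aeval f (∏ p ∈ s, (X ^ (q / p) - 1 : ℂ[X]))) := by
      refine Finset.prod_induction _ (fun P ↦ Commute (ρ B) (aeval f P))
        (fun P Q hP hQ ↦ by rw [map_mul]; exact hP.mul_right hQ)
        (by rw [map_one]; exact Commute.one_right _) (fun p' hp' ↦ ?_)
      have hp'q := Nat.mem_primeFactors.1 (hs.2 hp')
      have hcop' : Nat.Coprime (p ^ k) p' :=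
        ((Nat.coprime_primes hp.1 hp'q.1).2 (fun h ↦ hps (h ▸ hp'))).pow_left k
      have hdvd : p ^ k ∣ q / p' := by
        refine Nat.Coprime.dvd_of_dvd_mul_left hcop' ?_
        rw [Nat.mul_div_cancel' hp'q.2.1, hqm]
        exact dvd_mul_right _ _
      obtain ⟨d, hd⟩ := hdvd
      rw [map_sub, map_pow, aeval_X, map_one, hfn, hd, Nat.cast_mul]
      exact ((hB _ _).map ρ).sub_right (Commute.one_right _)
    rw [map_mul, mul_assoc, mul_assoc, hBf.eq, ← mul_assoc, ← hCf.eq, mul_assoc,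
      ← mul_assoc _ _ (ρ B), h0, zero_mul, mul_zero]

/-- A new irreducible representation has at least as many dimensions as there are squares of
units modulo `q`. -/
theorem card_sq_le_finrank [NeZero q] (hg : g ≠ 0) {ρ : Representation ℂ (SpMod g q) V}
    (hρ : ρ.IsIrreducible) (hnew : IsNew ρ) :
    (Finset.univ.image fun u : (ZMod q)ˣ ↦ u ^ 2).card ≤ Module.finrank ℂ V := by
  have := hρ.finiteDimensional
  have : NeZero g := ⟨hg⟩
  let e : Fin g ⊕ Fin g → ZMod q := Sum.elim (Pi.single 0 1) 0
  set f : Module.End ℂ V := ρ (transvection e 1) with hf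
  have hfn : ∀ n : ℕ, f ^ n = ρ (transvection e (n : ZMod q)) := fun n ↦ by
    rw [hf, ← map_pow, transvection_natCast]
  have hfq : f ^ q = 1 := by
    rw [hfn, ZMod.natCast_self, SymplecticGroup.transvection_zero, map_one]
  obtain ⟨ζ, hζ, hord⟩ := Module.End.exists_hasEigenvalue_orderOf_eq (NeZero.ne q) hfq
    (aeval_prod_primeFactors_ne_zero hρ e (fun p hp h ↦ by
      have hp := Nat.mem_primeFactors.1 hp
      have : Fact p.Prime := ⟨hp.1⟩
      have hqp : q = p * (q / p) := (Nat.mul_div_cancel' hp.2.1).symm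
      have hdvd : q / p ∣ q := Nat.div_dvd_of_dvd hp.2.1
      rw [← hf, hfn] at h
      refine hnew (q / p) hdvd (Nat.div_lt_self (NeZero.pos q) hp.1.one_lt).ne
        (factorsThrough_of_transvection_eq_one hqp hdvd (e := e) (fun h0 ↦ ?_) ρ h)
      have := congrFun h0 (Sum.inl 0)
      have he0 : e (Sum.inl 0) = 1 := Pi.single_eq_same _ _
      rw [Function.comp_apply, he0, map_one] at this
      exact one_ne_zero this) _ subset_rfl)
  have hconj : ∀ u : (ZMod q)ˣ, f.HasEigenvalue (ζ ^ ((u ^ 2 : (ZMod q)ˣ) : ZMod q).val) := by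
    intro u
    obtain ⟨v, hv⟩ := hζ.exists_hasEigenvector
    let A : SpMod g q := scalarUnit u
    have hA : A * transvection e 1 * A⁻¹ = transvection e 1 ^ ((u ^ 2 : (ZMod q)ˣ) : ZMod q).val := by
      rw [conj_transvection, scalarUnit_mulVec_inl]
      change transvection ((u : ZMod q) • e) 1 = _
      rw [transvection_smul, ← transvection_natCast, ZMod.natCast_zmod_val, mul_one,
        Units.val_pow_eq_pow_val]
    refine Module.End.hasEigenvalue_of_hasEigenvector (x := ρ A⁻¹ v)
      ⟨Module.End.mem_eigenspace_iff.2 ?_, fun h0 ↦ hv.2 ?_⟩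
    · have h1 : transvection e 1 * A⁻¹ =
          A⁻¹ * transvection e 1 ^ ((u ^ 2 : (ZMod q)ˣ) : ZMod q).val := by
        rw [← hA]; group
      rw [hf, ← Module.End.mul_apply, ← map_mul, h1, map_mul, map_pow, Module.End.mul_apply,
        ← hf, hv.pow_apply, map_smul]
    · have := congrArg (ρ A) h0
      rwa [← Module.End.mul_apply, ← map_mul, mul_inv_cancel, map_one, map_zero] at this
  have hinj : Function.Injective fun u : (ZMod q)ˣ ↦ ζ ^ (u : ZMod q).val := by
    intro u w huw
    refine Units.ext (ZMod.val_injective q ?_)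
    exact pow_injOn_Iio_orderOf (by simpa [hord] using ZMod.val_lt _)
      (by simpa [hord] using ZMod.val_lt _) huw
  rw [← Finset.card_image_of_injective _ hinj]
  refine Module.End.card_le_finrank_of_hasEigenvalue (f := f) _ fun μ hμ ↦ ?_
  simp only [Finset.image_image, Finset.mem_image] at hμ
  obtain ⟨u, -, rfl⟩ := hμ
  exact hconj u

end SpMod

/-! ### Counting squares of units -/

theorem Nat.card_divisors_le_two_mul_sqrt (n : ℕ) : n.divisors.card ≤ 2 * n.sqrt := by
  have hsub : n.divisors ⊆ Finset.Icc 1 n.sqrt ∪ (Finset.Icc 1 n.sqrt).image (n / ·) := by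
    intro d hd
    obtain ⟨⟨k, rfl⟩, h0⟩ := Nat.mem_divisors.1 hd
    rw [mul_ne_zero_iff] at h0
    rw [Finset.mem_union, Finset.mem_image]
    rcases le_total d k with h | h
    · exact Or.inl (Finset.mem_Icc.2 ⟨Nat.pos_of_ne_zero h0.1,
        Nat.le_sqrt.2 (Nat.mul_le_mul_left d h)⟩)
    · exact Or.inr ⟨k, Finset.mem_Icc.2 ⟨Nat.pos_of_ne_zero h0.2,
        Nat.le_sqrt.2 (Nat.mul_le_mul_right k h)⟩,
        Nat.mul_div_cancel _ (Nat.pos_of_ne_zero h0.2)⟩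
  calc n.divisors.card ≤ _ := Finset.card_le_card hsub
    _ ≤ _ := Finset.card_union_le _ _
    _ ≤ n.sqrt + n.sqrt := by
      gcongr
      · simp
      · exact Finset.card_image_le.trans (by simp)
    _ = 2 * n.sqrt := by ring

/-- Each prime satisfies `p ≤ 2 (p - 1)`. -/
theorem Nat.le_totient_mul_two_pow_card_primeFactors (n : ℕ) :
    n ≤ n.totient * 2 ^ n.primeFactors.card := by
  have hpos : 0 < ∏ p ∈ n.primeFactors, (p - 1) :=
    Finset.prod_pos fun p hp ↦ Nat.sub_pos_of_lt (Nat.prime_of_mem_primeFactors hp).one_lt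
  refine Nat.le_of_mul_le_mul_right ?_ hpos
  rw [← Nat.totient_mul_prod_primeFactors, mul_assoc, ← Finset.prod_const,
    ← Finset.prod_mul_distrib]
  refine Nat.mul_le_mul_left _ (Finset.prod_le_prod' fun p hp ↦ ?_)
  have := (Nat.prime_of_mem_primeFactors hp).two_le
  omega

theorem Nat.exists_two_pow_card_primeFactors_le {ε : ℝ} (hε : 0 < ε) :
    ∃ K : ℝ, 0 < K ∧ ∀ n : ℕ, n ≠ 0 → (2 : ℝ) ^ n.primeFactors.card ≤ K * (n : ℝ) ^ ε := by
  -- Primes `p ≥ N` have `p ^ ε ≥ 2`; the fewer than `N + 1` smaller ones cost at most `2 ^ N`.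
  obtain ⟨N, hN⟩ := Filter.Eventually.exists_forall_of_atTop
    (((tendsto_rpow_atTop hε).comp tendsto_natCast_atTop_atTop).eventually_ge_atTop 2)
  refine ⟨2 ^ N, by positivity, fun n hn ↦ ?_⟩
  calc (2 : ℝ) ^ n.primeFactors.card = ∏ p ∈ n.primeFactors, (2 : ℝ) := by
        rw [Finset.prod_const]
    _ ≤ ∏ p ∈ n.primeFactors, ((if p < N then 2 else 1) * (p : ℝ) ^ ε) := by
        refine Finset.prod_le_prod (fun _ _ ↦ zero_le_two) fun p hp ↦ ?_
        split_ifs with h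
        · have h1 : (1 : ℝ) ≤ p := by
            exact_mod_cast (Nat.prime_of_mem_primeFactors hp).one_lt.le
          have := Real.one_le_rpow h1 hε.le
          linarith
        · rw [one_mul]
          exact hN p (not_lt.1 h)
    _ = (∏ p ∈ n.primeFactors, if p < N then (2 : ℝ) else 1) *
          ((∏ p ∈ n.primeFactors, p : ℕ) : ℝ) ^ ε := by
        rw [Finset.prod_mul_distrib, Real.finsetProd_rpow _ _ (fun p _ ↦ Nat.cast_nonneg p),
          Nat.cast_prod]
    _ ≤ 2 ^ N * (n : ℝ) ^ ε := by
        gcongr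
        · rw [← Finset.prod_filter, Finset.prod_const]
          refine pow_le_pow_right₀ one_le_two ?_
          calc _ ≤ (Finset.range N).card := Finset.card_le_card fun p hp ↦
                Finset.mem_range.2 (Finset.mem_filter.1 hp).2
            _ = N := Finset.card_range N
        · exact Nat.le_of_dvd (Nat.pos_of_ne_zero hn) (Nat.prod_primeFactors_dvd n)

namespace ZMod

theorem card_filter_two_mul_eq_zero_le (q : ℕ) [NeZero q] :
    (Finset.univ.filter fun z : ZMod q ↦ 2 * z = 0).card ≤ 2 := by
  calc _ = ((Finset.univ.filter fun z : ZMod q ↦ 2 * z = 0).image ZMod.val).card :=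
        (Finset.card_image_of_injective _ (val_injective q)).symm
    _ ≤ ({0, q / 2} : Finset ℕ).card := Finset.card_le_card fun n hn ↦ by
        obtain ⟨z, hz, rfl⟩ := Finset.mem_image.1 hn
        have hz := (Finset.mem_filter.1 hz).2
        rw [← natCast_zmod_val z, ← Nat.cast_ofNat, ← Nat.cast_mul, natCast_eq_zero_iff] at hz
        obtain ⟨k, hk⟩ := hz
        have hlt := val_lt z
        have hk2 : k < 2 := by
          by_contra! h
          nlinarith
        rw [Finset.mem_insert, Finset.mem_singleton]
        interval_cases k <;> omega
    _ ≤ 2 := Finset.card_le_two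

/-- Modulo `q` there are at most `2 τ(q)` solutions of `x ^ 2 = 1`. -/
theorem card_filter_sq_eq_one_le (q : ℕ) [NeZero q] :
    (Finset.univ.filter fun x : ZMod q ↦ x ^ 2 = 1).card ≤ 2 * q.divisors.card := by
  refine Finset.card_le_mul_card_image_of_maps_to (f := fun x ↦ Nat.gcd (x - 1).val q)
    (fun x _ ↦ Nat.mem_divisors.2 ⟨Nat.gcd_dvd_right _ _, NeZero.ne q⟩) 2 fun d hd ↦ ?_
  obtain ⟨⟨k, hk⟩, -⟩ := Nat.mem_divisors.1 hd
  have hd0 : d ≠ 0 := fun h ↦ NeZero.ne q (by rw [hk, h, zero_mul])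
  have key : ∀ x : ZMod q, x ^ 2 = 1 → Nat.gcd (x - 1).val q = d →
      (d : ZMod q) ∣ x - 1 ∧ (k : ZMod q) ∣ x + 1 := by
    intro x hx hxd
    have h1 : (d : ZMod q) ∣ x - 1 := by
      rw [← natCast_zmod_val (x - 1)]
      exact Nat.cast_dvd_cast (hxd ▸ Nat.gcd_dvd_left _ _)
    have h2 : k ∣ (x + 1).val := by
      have h3 : q ∣ (x - 1).val * (x + 1).val := by
        rw [← natCast_eq_zero_iff, Nat.cast_mul, natCast_zmod_val, natCast_zmod_val]
        linear_combination hx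
      have h4 : q / d ∣ (x - 1).val / d * (x + 1).val := by
        refine Nat.dvd_of_mul_dvd_mul_left (Nat.pos_of_ne_zero hd0) ?_
        rw [Nat.mul_div_cancel' ⟨k, hk⟩, ← mul_assoc,
          Nat.mul_div_cancel' (hxd ▸ Nat.gcd_dvd_left _ _)]
        exact h3
      have hcop : Nat.Coprime (q / d) ((x - 1).val / d) := by
        rw [Nat.coprime_comm]
        have := Nat.coprime_div_gcd_div_gcd
          (Nat.gcd_pos_of_pos_right (x - 1).val (NeZero.pos q))
        rwa [hxd] at this
      have h5 := hcop.dvd_of_dvd_mul_left h4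
      rwa [Nat.div_eq_of_eq_mul_right (Nat.pos_of_ne_zero hd0) hk] at h5
    refine ⟨h1, ?_⟩
    rw [← natCast_zmod_val (x + 1)]
    exact Nat.cast_dvd_cast h2
  have hdk : (d : ZMod q) * k = 0 := by rw [← Nat.cast_mul, ← hk, natCast_self]
  rcases Finset.eq_empty_or_nonempty
    ((Finset.univ.filter fun x : ZMod q ↦ x ^ 2 = 1).filter fun x ↦ (x - 1).val.gcd q = d)
    with h | ⟨y, hy⟩
  · rw [h]; simp
  simp only [Finset.mem_filter, Finset.mem_univ, true_and] at hy
  obtain ⟨⟨a, ha⟩, ⟨b, hb⟩⟩ := key y hy.1 hy.2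
  -- Differences in a fibre are killed by 2: `2 (x - y) = (x - y)(y + 1) - (x - y)(y - 1)`, where
  -- `d` and `k` both divide `x - y`, `k ∣ y + 1`, `d ∣ y - 1` and `d k = 0`.
  refine le_trans ?_ (card_filter_two_mul_eq_zero_le q)
  refine Finset.card_le_card_of_injOn (fun x ↦ x - y) (fun x hx ↦ ?_)
    (fun x _ z _ h ↦ sub_left_injective h)
  simp only [Finset.coe_filter, Finset.mem_filter, Finset.mem_univ, true_and,
    Set.mem_ofPred_eq] at hx ⊢
  obtain ⟨⟨a', ha'⟩, ⟨b', hb'⟩⟩ := key x hx.1 hx.2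
  linear_combination (x - y) * hb - (x - y) * ha + k * b * (ha' - ha) - d * a * (hb' - hb) +
    (b * (a' - a) - a * (b' - b)) * hdk

theorem totient_le_card_sq_mul (q : ℕ) [NeZero q] :
    q.totient ≤ 2 * q.divisors.card * (Finset.univ.image fun u : (ZMod q)ˣ ↦ u ^ 2).card := by
  rw [← card_units_eq_totient, ← Finset.card_univ]
  refine Finset.card_le_mul_card_image _ _ fun w hw ↦ ?_
  obtain ⟨v, -, rfl⟩ := Finset.mem_image.1 hw
  refine le_trans ?_ (card_filter_sq_eq_one_le q)
  refine Finset.card_le_card_of_injOn (fun u ↦ ((u * v⁻¹ : (ZMod q)ˣ) : ZMod q)) (fun u hu ↦ ?_)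
    (fun x _ y _ h ↦ mul_left_injective _ (Units.ext h))
  simp only [Finset.coe_filter, Finset.mem_univ, true_and, Set.mem_ofPred_eq] at hu ⊢
  rw [← Units.val_pow_eq_pow_val, mul_pow, hu, inv_pow, mul_inv_cancel, Units.val_one]

theorem exists_mul_rpow_le_card_sq {D : ℝ} (hD : D < 1 / 2) :
    ∃ C : ℝ, 0 < C ∧ ∀ (q : ℕ) [NeZero q],
      C * (q : ℝ) ^ D ≤ (Finset.univ.image fun u : (ZMod q)ˣ ↦ u ^ 2).card := by
  obtain ⟨K, hK, hKq⟩ := Nat.exists_two_pow_card_primeFactors_le (sub_pos.2 hD)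
  -- The 4 comes from `2 τ(q) ≤ 4 √q`, and `K` from `2 ^ ω(q) ≤ K q ^ (1/2 - D)`, with `ω(q)` the
  -- number of prime factors.
  refine ⟨(4 * K)⁻¹, by positivity, fun q _ ↦ ?_⟩
  set s := (Finset.univ.image fun u : (ZMod q)ˣ ↦ u ^ 2).card
  have hq : (0 : ℝ) < q := Nat.cast_pos.2 (NeZero.pos q)
  have h1 : q ≤ 2 * (2 * q.sqrt) * s * 2 ^ q.primeFactors.card :=
    (Nat.le_totient_mul_two_pow_card_primeFactors q).trans (Nat.mul_le_mul_right _
      ((totient_le_card_sq_mul q).trans (Nat.mul_le_mul_right _ (Nat.mul_le_mul_left _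
        (Nat.card_divisors_le_two_mul_sqrt q)))))
  have h2 : (q : ℝ) ≤ 4 * (q : ℝ) ^ (1 / 2 : ℝ) * s * (K * (q : ℝ) ^ (1 / 2 - D)) := by
    calc (q : ℝ) ≤ 2 * (2 * q.sqrt) * s * 2 ^ q.primeFactors.card := by exact_mod_cast h1
      _ ≤ 2 * (2 * (q : ℝ) ^ (1 / 2 : ℝ)) * s * (K * (q : ℝ) ^ (1 / 2 - D)) := by
        gcongr
        · rw [← Real.sqrt_eq_rpow]
          exact Real.nat_sqrt_le_real_sqrt
        · exact hKq q (NeZero.ne q)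
      _ = _ := by ring
  have h3 : (q : ℝ) ^ (1 / 2 : ℝ) * (q : ℝ) ^ (1 / 2 - D) * (q : ℝ) ^ D = q := by
    rw [← Real.rpow_add hq, ← Real.rpow_add hq]
    convert Real.rpow_one (q : ℝ) using 2
    ring
  rw [inv_mul_le_iff₀ (by positivity)]
  refine le_of_mul_le_mul_left ?_
    (mul_pos (Real.rpow_pos_of_pos hq (1 / 2)) (Real.rpow_pos_of_pos hq (1 / 2 - D)))
  rw [h3]
  linarith

end ZMod

theorem mainTheorem5 (g : ℕ) (hg : 2 ≤ g) (D : ℝ) (hD : 0 < D) (hD' : D < 1 / 2) :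
    ∃ C : ℝ, 0 < C ∧
      ∀ (q : ℕ), 1 ≤ q →
        ∀ (V : Type*) [AddCommGroup V] [Module ℂ V] (ρ : Representation ℂ (SpMod g q) V),
          ρ.IsIrreducible → SpMod.IsNew ρ →
            C * (q : ℝ) ^ D ≤ (Module.finrank ℂ V : ℝ) := by
  obtain ⟨C, hC, h⟩ := ZMod.exists_mul_rpow_le_card_sq hD'
  refine ⟨C, hC, fun q hq V _ _ ρ hρ hnew ↦ ?_⟩
  have : NeZero q := ⟨by omega⟩
  exact (h q).trans (Nat.cast_le.2 (SpMod.card_sq_le_finrank (by omega) hρ hnew))
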